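/- Let $l\ge 0$ and let $r_1,r_2,r_3,r_4\ge 0$ be integers with $r_1+r_2+r_3+r_4=2l+1$. Put $G=SO(2l+1)$, let $H=SO(r_1)\times SO(r_2)\times SO(r_3)\times SO(r_4)$ be the subgroup of block diagonal matrices, and $M=G/H$. Write the elements of $\mathfrak g=\mathfrak{so}(2l+1)$ as skew-symmetric block matrices $$\begin{pmatrix} X_1&A_1&B_1&C_1\\ -{}^tA_1&X_2&C_2&B_2\\ -{}^tB_1&-{}^tC_2&X_3&A_2\\ -{}^tC_1&-{}^tB_2&-{}^tA_2&X_4\end{pmatrix},$$ and give $\mathfrak g$ the $\mathbb Z_2\times\mathbb Z_2$-grading $\mathfrak g=\mathfrak g_e\oplus\mathfrak g_a\oplus\mathfrak g_b\oplus\mathfrak g_c$, where $\mathfrak g_e=\bigoplus_i\mathfrak{so}(r_i)$ is the diagonal part and $\mathfrak g_a,\mathfrak g_b,\mathfrak g_c$ consist of the matrices whose only nonzero blocks are those named $A_1,A_2$, respectively $B_1,B_2$, respectively $C_1,C_2$ (and their transposes). Put $\mathfrak m=\mathfrak g_a\oplus\mathfrak g_b\oplus\mathfrak g_c\cong T_{eH}M$.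 Let $\nabla$ be the canonical connection of the reductive homogeneous space $M$ with $\mathfrak g=\mathfrak g_e\oplus\mathfrak m$ (the $G$-invariant connection defined by the $\mathfrak g_e$-component of the Maurer-Cartan form of $G$), whose torsion at the origin is $T(X,Y)=-[X,Y]_{\mathfrak m}$, and let $\overline\nabla=\nabla-\tfrac12T$ be the canonical torsion-free connection. A $G$-invariant Riemannian metric on $M$ is called adapted to the $\mathbb Z_2\times\mathbb Z_2$-symmetric structure if its Levi-Civita connection equals $\overline\nabla$. Then every $G$-invariant Riemannian metric on $M$ that is adapted to the $\mathbb Z_2\times\mathbb Z_2$-symmetric structure is given by an inner product on $\mathfrak m$ of the form $$B=t\Big(\sum(\alpha^1_{ij})^2+\sum(\alpha^2_{ij})^2+\sum(\beta^1_{ij})^2+\sum(\beta^2_{ij})^2+\sum(\gamma^1_{ij})^2+\sum(\gamma^2_{ij})^2\Big),\qquad t>0,$$ where $\alpha^1_{ij},\alpha^2_{ij},\beta^1_{ij},\beta^2_{ij},\gamma^1_{ij},\gamma^2_{ij}$ are the entries of the blocks $A_1,A_2,B_1,B_2,C_1,C_2$. -/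

import Mathlib

open scoped Matrix ContDiff Topology

noncomputable section

namespace FlagManifold

open scoped Matrix.Norms.Operator in
theorem hasDerivAt_exp_entry {ι : Type*} [Fintype ι] [DecidableEq ι] (X : Matrix ι ι ℝ) (p q : ι) :
    HasDerivAt (fun t : ℝ => NormedSpace.exp (t • X) p q) (X p q) 0 := by
  have h := hasDerivAt_exp_smul_const (𝕂 := ℝ) X (0 : ℝ)
  rw [zero_smul, NormedSpace.exp_zero, one_mul] at h
  exact (Matrix.entryLinearMap ℝ ℝ p q).toContinuousLinearMap.hasFDerivAt.comp_hasDerivAt 0 h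

attribute [local instance] Matrix.normedAddCommGroup Matrix.normedSpace

/-- Matrix indices: the pair `⟨i, a⟩` is the `a`-th row of the `i`-th of the four diagonal blocks,
whose sizes are `r 0, r 1, r 2, r 3`. -/
abbrev Idx (r : Fin 4 → ℕ) : Type := Σ i : Fin 4, Fin (r i)

abbrev Mat (r : Fin 4 → ℕ) : Type := Matrix (Idx r) (Idx r) ℝ

/-- The group `SO(r₁ + r₂ + r₃ + r₄)`. -/
abbrev G (r : Fin 4 → ℕ) : Type := Matrix.specialOrthogonalGroup (Idx r) ℝ

theorem coe_inv {r : Fin 4 → ℕ} (g : G r) : ((g⁻¹ : G r) : Mat r) = (g : Mat r)ᵀ := rfl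

theorem blockDiagonal_mem {r : Fin 4 → ℕ} {M : ∀ i, Matrix (Fin (r i)) (Fin (r i)) ℝ}
    (hM : ∀ i, M i ∈ Matrix.specialOrthogonalGroup (Fin (r i)) ℝ) :
    Matrix.blockDiagonal' M ∈ Matrix.specialOrthogonalGroup (Idx r) ℝ := by
  have h1 : ∀ i, M i * (M i)ᵀ = 1 := fun i => by
    have := (Matrix.mem_specialOrthogonalGroup_iff.1 (hM i)).1
    exact (Matrix.mem_orthogonalGroup_iff _ _).1 this
  have h2 : ∀ i, (M i).det = 1 := fun i => (Matrix.mem_specialOrthogonalGroup_iff.1 (hM i)).2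
  refine Matrix.mem_specialOrthogonalGroup_iff.2 ⟨?_, ?_⟩
  · refine (Matrix.mem_orthogonalGroup_iff _ _).2 ?_
    change Matrix.blockDiagonal' M * (Matrix.blockDiagonal' M)ᵀ = 1
    rw [Matrix.blockDiagonal'_transpose, ← Matrix.blockDiagonal'_mul]
    simp only [h1]
    exact Matrix.blockDiagonal'_one
  · have ht : (Matrix.blockDiagonal' M).BlockTriangular (Sigma.fst : Idx r → Fin 4) := by
      rintro ⟨i, a⟩ ⟨j, b⟩ h
      exact Matrix.blockDiagonal'_apply_ne _ _ _ (ne_of_gt h)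
    rw [ht.det_fintype]
    refine Finset.prod_eq_one fun k _ => ?_
    let e : Fin (r k) ≃ {p : Idx r // p.1 = k} :=
      { toFun := fun a => ⟨⟨k, a⟩, rfl⟩
        invFun := fun p => p.2 ▸ p.1.2
        left_inv := fun a => rfl
        right_inv := by rintro ⟨⟨i, a⟩, rfl⟩; rfl }
    rw [← Matrix.det_submatrix_equiv_self e, ← h2 k]
    congr 1
    ext a b
    exact Matrix.blockDiagonal'_apply_eq M k a b

/-- The block homomorphism `SO(r₁) × SO(r₂) × SO(r₃) × SO(r₄) → SO(r₁ + r₂ + r₃ + r₄)`. -/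
def blockHom (r : Fin 4 → ℕ) :
    (∀ i, Matrix.specialOrthogonalGroup (Fin (r i)) ℝ) →* G r where
  toFun M := ⟨Matrix.blockDiagonal' fun i => (M i : Matrix (Fin (r i)) (Fin (r i)) ℝ),
    blockDiagonal_mem fun i => (M i).2⟩
  map_one' := Subtype.ext (Matrix.blockDiagonal'_one)
  map_mul' M N := Subtype.ext (Matrix.blockDiagonal'_mul
    (fun i => (M i : Matrix (Fin (r i)) (Fin (r i)) ℝ))
    (fun i => (N i : Matrix (Fin (r i)) (Fin (r i)) ℝ)))

/-- The subgroup `SO(r₁) × SO(r₂) × SO(r₃) × SO(r₄)` of block diagonal matrices. -/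
def H (r : Fin 4 → ℕ) : Subgroup (G r) := (blockHom r).range

/-- The flag manifold `M = SO(r₁ + ⋯ + r₄) / SO(r₁) × SO(r₂) × SO(r₃) × SO(r₄)`. -/
abbrev M (r : Fin 4 → ℕ) : Type := G r ⧸ H r

theorem H_apply {r : Fin 4 → ℕ} (h : H r) {p q : Idx r} (hpq : p.1 ≠ q.1) :
    ((h : G r) : Mat r) p q = 0 := by
  obtain ⟨_, N, rfl⟩ := h
  obtain ⟨i, a⟩ := p
  obtain ⟨j, b⟩ := q
  exact Matrix.blockDiagonal'_apply_ne
    (fun i => (N i : Matrix (Fin (r i)) (Fin (r i)) ℝ)) a b hpq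

/-! ### The `ℤ₂ × ℤ₂`-grading of `so(r₁ + ⋯ + r₄)` -/

/-- The labels `e, a, b, c` in `ℤ₂ × ℤ₂` of the four blocks. -/
def label : Fin 4 → ZMod 2 × ZMod 2 := ![(0, 0), (1, 0), (0, 1), (1, 1)]

/-- The homogeneous component of degree `γ`: skew-symmetric matrices whose only nonzero blocks are
those at the positions `(i, j)` with `label i + label j = γ`. Hence the component of degree `0` is
`so(r₁) ⊕ ⋯ ⊕ so(r₄)`, and those of degree `(1,0), (0,1), (1,1)` are
`A₁ ⊕ A₂`, `B₁ ⊕ B₂`, `C₁ ⊕ C₂`, where `A₁, A₂` are the blocks `(1,2), (3,4)`,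
`B₁, B₂` the blocks `(1,3), (2,4)` and `C₁, C₂` the blocks `(1,4), (2,3)`. -/
def component (r : Fin 4 → ℕ) (γ : ZMod 2 × ZMod 2) : Submodule ℝ (Mat r) where
  carrier := {X | Xᵀ = -X ∧ ∀ p q : Idx r, label p.1 + label q.1 ≠ γ → X p q = 0}
  zero_mem' := by simp
  add_mem' := by
    rintro X Y ⟨hX, hX'⟩ ⟨hY, hY'⟩
    refine ⟨by rw [Matrix.transpose_add, hX, hY]; abel, fun p q h => ?_⟩
    simp [hX' p q h, hY' p q h]
  smul_mem' := by
    rintro c X ⟨hX, hX'⟩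
    refine ⟨by rw [Matrix.transpose_smul, hX, smul_neg], fun p q h => ?_⟩
    simp [hX' p q h]

/-- `𝔪 = 𝔤_a ⊕ 𝔤_b ⊕ 𝔤_c`, the complement of `𝔤_e` given by the grading; it is the model of the
tangent space of `M` at the origin. -/
def m (r : Fin 4 → ℕ) : Submodule ℝ (Mat r) :=
  ⨆ γ : {γ : ZMod 2 × ZMod 2 // γ ≠ 0}, component r γ

theorem label_add_eq_zero (i j : Fin 4) : label i + label j = 0 ↔ i = j := by
  revert i j; decide

theorem mem_m {r : Fin 4 → ℕ} {X : Mat r} :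
    X ∈ m r ↔ Xᵀ = -X ∧ ∀ p q : Idx r, p.1 = q.1 → X p q = 0 := by
  constructor
  · intro hX
    refine Submodule.iSup_induction _ (motive := fun X : Mat r =>
      Xᵀ = -X ∧ ∀ p q : Idx r, p.1 = q.1 → X p q = 0) hX ?_ ?_ ?_
    · rintro ⟨γ, hγ⟩ Y ⟨hY, hY'⟩
      refine ⟨hY, fun p q hpq => hY' p q ?_⟩
      rw [(label_add_eq_zero _ _).2 hpq]
      exact hγ.symm
    · simp
    · rintro Y Z ⟨hY, hY'⟩ ⟨hZ, hZ'⟩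
      refine ⟨by rw [Matrix.transpose_add, hY, hZ]; abel, fun p q h => ?_⟩
      simp [hY' p q h, hZ' p q h]
  · rintro ⟨hX, hX'⟩
    let P : (ZMod 2 × ZMod 2) → Mat r := fun γ =>
      Matrix.of fun p q => if label p.1 + label q.1 = γ then X p q else 0
    have hsum : X = ∑ γ : {γ : ZMod 2 × ZMod 2 // γ ≠ 0}, P γ := by
      ext p q
      rw [Matrix.sum_apply]
      by_cases h : label p.1 + label q.1 = 0
      · rw [hX' p q ((label_add_eq_zero _ _).1 h), Finset.sum_eq_zero]
        rintro ⟨γ, hγ⟩ -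
        simp [P, h, hγ.symm]
      · rw [Finset.sum_eq_single (⟨label p.1 + label q.1, h⟩ : {γ : ZMod 2 × ZMod 2 // γ ≠ 0})]
        · simp [P]
        · rintro ⟨γ, hγ⟩ - hne
          have : label p.1 + label q.1 ≠ γ := fun h' => hne (Subtype.ext h'.symm)
          simp [P, this]
        · simp
    rw [hsum]
    refine Submodule.sum_mem _ fun γ _ => Submodule.mem_iSup_of_mem γ ⟨?_, fun p q h => ?_⟩
    · ext p q
      have h := congrFun (congrFun hX p) q
      simp only [Matrix.transpose_apply, Matrix.neg_apply] at h
      simp only [P, Matrix.transpose_apply, Matrix.of_apply, Matrix.neg_apply, h,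
        add_comm (label q.1)]
      split_ifs <;> simp
    · simp [P, h]

/-- The bracket `[X, Y]_𝔪`: the `𝔪`-component of the commutator of `X, Y ∈ 𝔪`. -/
def bracketM (r : Fin 4 → ℕ) : m r →ₗ[ℝ] m r →ₗ[ℝ] m r :=
  LinearMap.mk₂ ℝ
    (fun X Y => ⟨Matrix.of fun p q => if p.1 = q.1 then 0 else
        ((X : Mat r) * (Y : Mat r) - (Y : Mat r) * (X : Mat r)) p q, by
      have hX := (mem_m.1 X.2).1
      have hY := (mem_m.1 Y.2).1
      have h : ((X : Mat r) * (Y : Mat r) - (Y : Mat r) * (X : Mat r))ᵀ =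
          -((X : Mat r) * (Y : Mat r) - (Y : Mat r) * (X : Mat r)) := by
        rw [Matrix.transpose_sub, Matrix.transpose_mul, Matrix.transpose_mul, hX, hY]
        noncomm_ring
      refine mem_m.2 ⟨?_, fun p q hpq => by simp [hpq]⟩
      ext p q
      have h' := congrFun (congrFun h p) q
      simp only [Matrix.transpose_apply, Matrix.neg_apply] at h'
      simp only [Matrix.transpose_apply, Matrix.of_apply, Matrix.neg_apply, h', eq_comm (a := q.1)]
      split_ifs <;> simp⟩)
    (fun X X' Y => by
      ext p q; by_cases h : p.1 = q.1 <;> simp [h, add_mul, mul_add]; ring)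
    (fun c X Y => by
      ext p q; by_cases h : p.1 = q.1 <;> simp [h, mul_sub])
    (fun X Y Y' => by
      ext p q; by_cases h : p.1 = q.1 <;> simp [h, add_mul, mul_add]; ring)
    (fun c X Y => by
      ext p q; by_cases h : p.1 = q.1 <;> simp [h, mul_sub])

/-- The isotropy representation `Ad(h) X = h X h⁻¹` of `H` on `𝔪`. -/
def Ad {r : Fin 4 → ℕ} (h : H r) : m r →ₗ[ℝ] m r where
  toFun X := ⟨((h : G r) : Mat r) * X * (((h : G r)⁻¹ : G r) : Mat r), by
    obtain ⟨hX, hX'⟩ := mem_m.1 X.2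
    refine mem_m.2 ⟨?_, fun p q hpq => ?_⟩
    · rw [coe_inv, Matrix.transpose_mul, Matrix.transpose_mul, Matrix.transpose_transpose, hX]
      noncomm_ring
    · rw [coe_inv, Matrix.mul_apply]
      refine Finset.sum_eq_zero fun k _ => ?_
      by_cases hk : q.1 = k.1
      · rw [Matrix.mul_apply, Finset.sum_eq_zero, zero_mul]
        intro j _
        by_cases hj : p.1 = j.1
        · rw [hX' j k (hj.symm.trans (hpq.trans hk)), mul_zero]
        · rw [H_apply h hj, zero_mul]
      · rw [Matrix.transpose_apply, H_apply h hk, mul_zero]⟩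
  map_add' X Y := by ext1; simp [mul_add, add_mul]
  map_smul' c X := by ext1; simp

/-! ### Smooth functions and vector fields

Objects on `M` are described through their pullbacks along the submersion `G → M`. -/

/-- Smoothness of a map on the embedded submanifold `G` of the space of matrices: near each point
it is the restriction of a smooth map defined on a neighbourhood in the space of matrices. -/
def IsSmooth {r : Fin 4 → ℕ} {E : Type*} [NormedAddCommGroup E] [NormedSpace ℝ E]
    (F : G r → E) : Prop :=
  ∀ g : G r, ∃ F' : Mat r → E, ContDiffAt ℝ ∞ F' (g : Mat r) ∧ ∀ᶠ k : G r in 𝓝 g, F k = F' k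

theorem exp_mem {r : Fin 4 → ℕ} {X : Mat r} (hX : Xᵀ = -X) :
    NormedSpace.exp X ∈ Matrix.specialOrthogonalGroup (Idx r) ℝ := by
  have h : ∀ Y : Mat r, Yᵀ = -Y → NormedSpace.exp Y * (NormedSpace.exp Y)ᵀ = 1 := by
    intro Y hY
    rw [← Matrix.exp_transpose, hY, ← Matrix.exp_add_of_commute _ _ (Commute.refl Y).neg_right,
      add_neg_cancel, NormedSpace.exp_zero]
  refine Matrix.mem_specialOrthogonalGroup_iff.2
    ⟨(Matrix.mem_orthogonalGroup_iff _ _).2 (h X hX), ?_⟩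
  have h1 := congrArg Matrix.det (h ((2⁻¹ : ℝ) • X) (by rw [Matrix.transpose_smul, hX, smul_neg]))
  rw [Matrix.det_mul, Matrix.det_transpose, Matrix.det_one] at h1
  have h2 : X = (2⁻¹ : ℝ) • X + (2⁻¹ : ℝ) • X := by rw [← add_smul]; norm_num
  rw [h2, Matrix.exp_add_of_commute _ _ rfl, Matrix.det_mul, h1]

/-- The exponential map of `G`, restricted to `𝔪`. -/
def expG {r : Fin 4 → ℕ} (v : m r) : G r := ⟨NormedSpace.exp (v : Mat r), exp_mem (mem_m.1 v.2).1⟩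

/-- The derivative of `F` at `g` along the curve `t ↦ g exp(t v)`. For the pullback `F` of a function
on `M`, this is the derivative of that function along the tangent vector
`[g, v] = d/dt|₀ (g exp(t v) H)` at `gH`. -/
def dirDeriv {r : Fin 4 → ℕ} {E : Type*} [NormedAddCommGroup E] [NormedSpace ℝ E]
    (F : G r → E) (g : G r) (v : m r) : E :=
  deriv (fun t : ℝ => F (g * expG (t • v))) 0

theorem hasDerivAt_curve {r : Fin 4 → ℕ} (g : G r) (v : m r) :
    HasDerivAt (fun t : ℝ => ((g * expG (t • v) : G r) : Mat r)) ((g : Mat r) * (v : Mat r)) 0 := by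
  have h : HasDerivAt (fun t : ℝ => NormedSpace.exp (t • (v : Mat r))) (v : Mat r) 0 :=
    hasDerivAt_pi.2 fun p => hasDerivAt_pi.2 fun q => hasDerivAt_exp_entry (v : Mat r) p q
  exact (LinearMap.mulLeft ℝ (g : Mat r)).toContinuousLinearMap.hasFDerivAt.comp_hasDerivAt 0 h

theorem expG_zero {r : Fin 4 → ℕ} : expG (0 : m r) = 1 := Subtype.ext NormedSpace.exp_zero

theorem tendsto_curve {r : Fin 4 → ℕ} (g : G r) (v : m r) :
    Filter.Tendsto (fun t : ℝ => g * expG (t • v)) (𝓝 0) (𝓝 g) := by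
  refine tendsto_subtype_rng.2 ?_
  have h := (hasDerivAt_curve g v).continuousAt.tendsto
  rw [zero_smul, expG_zero, mul_one] at h
  exact h

section Smooth

variable {r : Fin 4 → ℕ} {E : Type*} [NormedAddCommGroup E] [NormedSpace ℝ E]
  {E' : Type*} [NormedAddCommGroup E'] [NormedSpace ℝ E']
  {E'' : Type*} [NormedAddCommGroup E''] [NormedSpace ℝ E'']

theorem hasDerivAt_of_extension {F : G r → E} {F' : Mat r → E} {g : G r}
    (hF' : DifferentiableAt ℝ F' (g : Mat r)) (h : ∀ᶠ k : G r in 𝓝 g, F k = F' k) (v : m r) :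
    HasDerivAt (fun t : ℝ => F (g * expG (t • v)))
      (fderiv ℝ F' (g : Mat r) ((g : Mat r) * (v : Mat r))) 0 := by
  have h0 : ((g * expG ((0 : ℝ) • v) : G r) : Mat r) = g := by simp [expG_zero]
  have h1 : HasDerivAt (fun t : ℝ => F' ((g * expG (t • v) : G r) : Mat r))
      (fderiv ℝ F' (g : Mat r) ((g : Mat r) * (v : Mat r))) 0 :=
    HasFDerivAt.comp_hasDerivAt_of_eq (0 : ℝ) hF'.hasFDerivAt (hasDerivAt_curve g v) h0.symm
  exact h1.congr_of_eventuallyEq ((tendsto_curve g v).eventually h)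

theorem IsSmooth.hasDerivAt {F : G r → E} (hF : IsSmooth F) (g : G r) (v : m r) :
    HasDerivAt (fun t : ℝ => F (g * expG (t • v))) (dirDeriv F g v) 0 := by
  obtain ⟨F', h1, h2⟩ := hF g
  exact (hasDerivAt_of_extension (h1.differentiableAt (by simp)) h2 v).differentiableAt.hasDerivAt

theorem isSmooth_const (c : E) : IsSmooth (fun _ : G r => c) :=
  fun _ => ⟨fun _ => c, contDiffAt_const, Filter.Eventually.of_forall fun _ => rfl⟩

theorem IsSmooth.add {F K : G r → E} (hF : IsSmooth F) (hK : IsSmooth K) :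
    IsSmooth (fun g => F g + K g) := fun g => by
  obtain ⟨F', h1, h2⟩ := hF g
  obtain ⟨K', h3, h4⟩ := hK g
  refine ⟨fun A => F' A + K' A, h1.add h3, ?_⟩
  filter_upwards [h2, h4] with k hk hk'
  rw [hk, hk']

theorem IsSmooth.smul {f : G r → ℝ} {F : G r → E} (hf : IsSmooth f) (hF : IsSmooth F) :
    IsSmooth (fun g => f g • F g) := fun g => by
  obtain ⟨f', h1, h2⟩ := hf g
  obtain ⟨F', h3, h4⟩ := hF g
  refine ⟨fun A => f' A • F' A, h1.smul h3, ?_⟩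
  filter_upwards [h2, h4] with k hk hk'
  rw [hk, hk']

theorem IsSmooth.bilinear [FiniteDimensional ℝ E] [FiniteDimensional ℝ E']
    (B : E →ₗ[ℝ] E' →ₗ[ℝ] E'') {F : G r → E} {K : G r → E'} (hF : IsSmooth F) (hK : IsSmooth K) :
    IsSmooth (fun g => B (F g) (K g)) := fun g => by
  obtain ⟨F', h1, h2⟩ := hF g
  obtain ⟨K', h3, h4⟩ := hK g
  refine ⟨fun A => B.toContinuousBilinearMap (F' A) (K' A),
    (B.toContinuousBilinearMap.contDiff.contDiffAt.comp _ h1).clm_apply h3, ?_⟩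
  filter_upwards [h2, h4] with k hk hk'
  rw [hk, hk', LinearMap.toContinuousBilinearMap_apply]

theorem IsSmooth.dirDeriv {F : G r → E} {X : G r → m r} (hF : IsSmooth F) (hX : IsSmooth X) :
    IsSmooth (fun g => dirDeriv F g (X g)) := fun g => by
  obtain ⟨F', h1, h2⟩ := hF g
  obtain ⟨X', h3, h4⟩ := hX g
  have hmul : ContDiffAt ℝ ∞ (fun A : Mat r => A * (X' A : Mat r)) (g : Mat r) := by
    have h5 : ContDiffAt ℝ ∞ (fun A : Mat r => (X' A : Mat r)) (g : Mat r) :=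
      (m r).subtypeL.contDiff.contDiffAt.comp _ h3
    exact ((LinearMap.mul ℝ (Mat r)).toContinuousBilinearMap.contDiff.contDiffAt).clm_apply h5
  refine ⟨fun A => fderiv ℝ F' A (A * (X' A : Mat r)),
    (h1.fderiv_right (by simp)).clm_apply hmul, ?_⟩
  have h6 : ∀ᶠ A in 𝓝 (g : Mat r), ContDiffAt ℝ 1 F' A :=
    (h1.of_le (by simp)).eventually (by simp)
  have h7 : ∀ᶠ k : G r in 𝓝 g, ContDiffAt ℝ 1 F' (k : Mat r) :=
    continuous_subtype_val.continuousAt.eventually h6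
  filter_upwards [h2.eventually_nhds, h4, h7] with k hk hk' hk''
  rw [← hk']
  exact (hasDerivAt_of_extension (hk''.differentiableAt (by simp)) hk (X k)).deriv

end Smooth

/-- Smooth real functions on `M`. -/
def SmoothFunction (r : Fin 4 → ℕ) : Type :=
  {f : M r → ℝ // IsSmooth fun g : G r => f (g : M r)}

/-- The pullback to `G` of a smooth function on `M`. -/
def SmoothFunction.lift {r : Fin 4 → ℕ} (f : SmoothFunction r) (g : G r) : ℝ := f.1 (g : M r)

theorem SmoothFunction.lift_mul {r : Fin 4 → ℕ} (f : SmoothFunction r) (g : G r) (h : H r) :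
    f.lift (g * (h : G r)) = f.lift g :=
  congrArg f.1 (QuotientGroup.mk_mul_of_mem g h.2)

/-- Smooth vector fields on `M`, that is smooth sections of `TM = G ×_H 𝔪`: smooth maps
`X : G → 𝔪` with `X(gh) = Ad(h⁻¹) X(g)`. The value of the vector field at `gH` is the velocity at
`t = 0` of the curve `g exp(t X(g)) H`. -/
def VectorField (r : Fin 4 → ℕ) : Submodule ℝ (G r → m r) where
  carrier := {X | IsSmooth X ∧ ∀ (g : G r) (h : H r), X (g * (h : G r)) = Ad h⁻¹ (X g)}
  zero_mem' := ⟨isSmooth_const 0, fun g h => (map_zero (Ad h⁻¹)).symm⟩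
  add_mem' := by
    rintro X Y ⟨hX, hX'⟩ ⟨hY, hY'⟩
    exact ⟨hX.add hY, fun g h => by simp [hX', hY']⟩
  smul_mem' := by
    rintro c X ⟨hX, hX'⟩
    exact ⟨(isSmooth_const c).smul hX, fun g h => by simp [hX']⟩

/-- The vector field `f X`. -/
def SmoothFunction.smulField {r : Fin 4 → ℕ} (f : SmoothFunction r) (X : VectorField r) :
    VectorField r :=
  ⟨fun g => f.lift g • X.1 g, IsSmooth.smul f.2 X.2.1, fun g h => by
    change f.lift (g * (h : G r)) • X.1 (g * (h : G r)) = Ad h⁻¹ (f.lift g • X.1 g)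
    rw [f.lift_mul, X.2.2, map_smul]⟩

/-- The derivative `X F` of the pullback `F` of a function on `M` along a vector field `X`
(again a function on `G`). -/
def fieldDeriv {r : Fin 4 → ℕ} (X : VectorField r) (F : G r → ℝ) (g : G r) : ℝ :=
  dirDeriv F g (X.1 g)

/-! ### Affine connections -/

/-- An affine connection (covariant derivative) `(X, Y) ↦ ∇_X Y` on `M`. -/
structure AffineConnection (r : Fin 4 → ℕ) where
  cov : VectorField r → VectorField r → VectorField r
  add_left : ∀ X X' Y, cov (X + X') Y = cov X Y + cov X' Y
  smul_left : ∀ (f : SmoothFunction r) (X Y), cov (f.smulField X) Y = f.smulField (cov X Y)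
  add_right : ∀ X Y Y', cov X (Y + Y') = cov X Y + cov X Y'
  leibniz : ∀ (f : SmoothFunction r) (X Y : VectorField r) (g : G r),
    (cov X (f.smulField Y)).1 g = f.lift g • (cov X Y).1 g + fieldDeriv X f.lift g • Y.1 g

/-- `∇` is torsion free: `∇_X Y - ∇_Y X = [X, Y]`, both sides being viewed as derivations of the
algebra of smooth functions on `M`. -/
def AffineConnection.IsTorsionFree {r : Fin 4 → ℕ} (D : AffineConnection r) : Prop :=
  ∀ (X Y : VectorField r) (f : SmoothFunction r) (g : G r),
    fieldDeriv (D.cov X Y) f.lift g - fieldDeriv (D.cov Y X) f.lift g =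
      fieldDeriv X (fieldDeriv Y f.lift) g - fieldDeriv Y (fieldDeriv X f.lift) g

theorem expG_Ad {r : Fin 4 → ℕ} (h : H r) (v : m r) :
    (h : G r) * expG (Ad h⁻¹ v) = expG v * (h : G r) := by
  have hu : (h : G r)⁻¹ * (h : G r) = 1 := inv_mul_cancel _
  have hu' : (h : G r) * (h : G r)⁻¹ = 1 := mul_inv_cancel _
  let u : (Mat r)ˣ := ⟨((h : G r) : Mat r), (((h : G r)⁻¹ : G r) : Mat r),
    congrArg Subtype.val hu', congrArg Subtype.val hu⟩
  have h1 : NormedSpace.exp ((u⁻¹ : (Mat r)ˣ) * (v : Mat r) * (u : Mat r)) =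
      (u⁻¹ : (Mat r)ˣ) * NormedSpace.exp (v : Mat r) * (u : Mat r) :=
    Matrix.exp_units_conj' u (v : Mat r)
  have h2 : ((Ad h⁻¹ v : m r) : Mat r) = (u⁻¹ : (Mat r)ˣ) * (v : Mat r) * (u : Mat r) := by
    simp only [Ad, LinearMap.coe_mk, AddHom.coe_mk, InvMemClass.coe_inv, inv_inv]
    rfl
  refine Subtype.ext ?_
  change (u : Mat r) * NormedSpace.exp ((Ad h⁻¹ v : m r) : Mat r) =
    NormedSpace.exp (v : Mat r) * (u : Mat r)
  rw [h2, h1, mul_assoc, Units.mul_inv_cancel_left]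

theorem dirDeriv_field_mul {r : Fin 4 → ℕ} (Y : VectorField r) (g : G r) (h : H r) (v : m r) :
    dirDeriv Y.1 (g * (h : G r)) (Ad h⁻¹ v) = Ad h⁻¹ (dirDeriv Y.1 g v) := by
  have h1 : (fun t : ℝ => Y.1 (g * (h : G r) * expG (t • Ad h⁻¹ v))) =
      fun t : ℝ => (Ad h⁻¹).toContinuousLinearMap (Y.1 (g * expG (t • v))) := by
    funext t
    rw [← map_smul, mul_assoc, expG_Ad, ← mul_assoc, Y.2.2]
    rfl
  have h2 := (Ad h⁻¹).toContinuousLinearMap.hasFDerivAt.comp_hasDerivAt (0 : ℝ)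
    (Y.2.1.hasDerivAt g v)
  unfold dirDeriv
  rw [h1]
  exact h2.deriv

theorem dirDeriv_linear {r : Fin 4 → ℕ} (Y : VectorField r) (g : G r) :
    ∃ L : m r →ₗ[ℝ] m r, ∀ v, dirDeriv Y.1 g v = L v := by
  obtain ⟨F', h1, h2⟩ := Y.2.1 g
  refine ⟨(fderiv ℝ F' (g : Mat r)).toLinearMap ∘ₗ LinearMap.mulLeft ℝ (g : Mat r) ∘ₗ
    (m r).subtype, fun v => ?_⟩
  exact (hasDerivAt_of_extension (h1.differentiableAt (by simp)) h2 v).deriv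

/-- The canonical connection `∇` of the reductive homogeneous space `M = G/H` with decomposition
`𝔤 = 𝔤_e ⊕ 𝔪`, given by the `𝔤_e`-component of the Maurer-Cartan form of `G`: the horizontal lift
of the tangent vector `[g, v]` to `G` is `g v`, and `∇` differentiates the `𝔪`-valued function
representing a vector field along the horizontal lift. -/
def canonicalConnection (r : Fin 4 → ℕ) : AffineConnection r where
  cov X Y := ⟨fun g => dirDeriv Y.1 g (X.1 g), Y.2.1.dirDeriv X.2.1, fun g h => by
    change dirDeriv Y.1 (g * (h : G r)) (X.1 (g * (h : G r))) = Ad h⁻¹ (dirDeriv Y.1 g (X.1 g))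
    rw [X.2.2, dirDeriv_field_mul]⟩
  add_left X X' Y := by
    refine Subtype.ext (funext fun g => ?_)
    obtain ⟨L, hL⟩ := dirDeriv_linear Y g
    change dirDeriv Y.1 g (X.1 g + X'.1 g) = dirDeriv Y.1 g (X.1 g) + dirDeriv Y.1 g (X'.1 g)
    simp only [hL, map_add]
  smul_left f X Y := by
    refine Subtype.ext (funext fun g => ?_)
    obtain ⟨L, hL⟩ := dirDeriv_linear Y g
    change dirDeriv Y.1 g (f.lift g • X.1 g) = f.lift g • dirDeriv Y.1 g (X.1 g)
    simp only [hL, map_smul]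
  add_right X Y Y' := by
    refine Subtype.ext (funext fun g => ?_)
    exact ((Y.2.1.hasDerivAt g (X.1 g)).add (Y'.2.1.hasDerivAt g (X.1 g))).deriv
  leibniz f X Y g := by
    have h1 : HasDerivAt (fun t : ℝ => f.lift (g * expG (t • X.1 g))) (fieldDeriv X f.lift g) 0 :=
      IsSmooth.hasDerivAt f.2 g (X.1 g)
    have h2 := (h1.smul (Y.2.1.hasDerivAt g (X.1 g))).deriv
    simp only [zero_smul, expG_zero, mul_one] at h2
    exact h2

theorem conj_offDiagonal {r : Fin 4 → ℕ} (h : H r) (Z : Mat r) :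
    ((h : G r) : Mat r) * (Matrix.of fun p q : Idx r => if p.1 = q.1 then 0 else Z p q) *
        ((h : G r) : Mat r)ᵀ =
      Matrix.of fun p q : Idx r => if p.1 = q.1 then 0 else
        (((h : G r) : Mat r) * Z * ((h : G r) : Mat r)ᵀ) p q := by
  ext p q
  simp only [Matrix.mul_apply, Matrix.transpose_apply, Matrix.of_apply, Finset.sum_mul]
  split_ifs with hpq
  · refine Finset.sum_eq_zero fun k _ => Finset.sum_eq_zero fun j _ => ?_
    by_cases hj : p.1 = j.1
    · by_cases hk : q.1 = k.1
      · rw [if_pos (hj.symm.trans (hpq.trans hk)), mul_zero, zero_mul]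
      · rw [H_apply h hk, mul_zero]
    · rw [H_apply h hj, zero_mul, zero_mul]
  · refine Finset.sum_congr rfl fun k _ => Finset.sum_congr rfl fun j _ => ?_
    by_cases hj : p.1 = j.1
    · by_cases hk : q.1 = k.1
      · rw [if_neg fun h' => hpq (hj.trans (h'.trans hk.symm))]
      · rw [H_apply h hk, mul_zero, mul_zero]
    · rw [H_apply h hj, zero_mul, zero_mul, zero_mul, zero_mul]

theorem Ad_bracketM {r : Fin 4 → ℕ} (h : H r) (v w : m r) :
    bracketM r (Ad h v) (Ad h w) = Ad h (bracketM r v w) := by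
  have hu : ((h : G r) : Mat r)ᵀ * ((h : G r) : Mat r) = 1 :=
    congrArg Subtype.val (inv_mul_cancel (h : G r))
  refine Subtype.ext ?_
  change _ = ((h : G r) : Mat r) * (Matrix.of fun p q : Idx r => if p.1 = q.1 then 0 else
    ((v : Mat r) * (w : Mat r) - (w : Mat r) * (v : Mat r)) p q) * ((h : G r) : Mat r)ᵀ
  rw [conj_offDiagonal]
  have key : ∀ x y : Mat r, ((h : G r) : Mat r) * x * ((h : G r) : Mat r)ᵀ *
      (((h : G r) : Mat r) * y * ((h : G r) : Mat r)ᵀ) =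
      ((h : G r) : Mat r) * (x * y) * ((h : G r) : Mat r)ᵀ := fun x y => by
    calc _ = ((h : G r) : Mat r) * x * (((h : G r) : Mat r)ᵀ * ((h : G r) : Mat r)) * y *
          ((h : G r) : Mat r)ᵀ := by noncomm_ring
      _ = _ := by rw [hu]; noncomm_ring
  have h2 : ((h : G r) : Mat r) * ((v : Mat r) * (w : Mat r) - (w : Mat r) * (v : Mat r)) *
      ((h : G r) : Mat r)ᵀ = ((Ad h v : m r) : Mat r) * ((Ad h w : m r) : Mat r) -
        ((Ad h w : m r) : Mat r) * ((Ad h v : m r) : Mat r) := by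
    change _ = ((h : G r) : Mat r) * v * ((h : G r) : Mat r)ᵀ *
      (((h : G r) : Mat r) * w * ((h : G r) : Mat r)ᵀ) -
      ((h : G r) : Mat r) * w * ((h : G r) : Mat r)ᵀ *
      (((h : G r) : Mat r) * v * ((h : G r) : Mat r)ᵀ)
    rw [key, key]
    noncomm_ring
  rw [h2]
  rfl

/-- The torsion of the canonical connection, `T(v, w) = -[v, w]_𝔪`. -/
def canonicalTorsion {r : Fin 4 → ℕ} (v w : m r) : m r := -bracketM r v w

/-- The canonical torsion free connection `∇ - T/2`, where `∇` is the canonical connection and `T`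
its torsion. -/
def torsionFreeConnection (r : Fin 4 → ℕ) : AffineConnection r where
  cov X Y := ⟨fun g => ((canonicalConnection r).cov X Y).1 g -
      (1 / 2 : ℝ) • canonicalTorsion (X.1 g) (Y.1 g), by
    refine ⟨?_, fun g h => ?_⟩
    · have h1 := ((canonicalConnection r).cov X Y).2.1.add ((isSmooth_const (1 / 2 : ℝ)).smul
        (IsSmooth.bilinear (bracketM r) X.2.1 Y.2.1))
      simpa only [canonicalTorsion, smul_neg, sub_neg_eq_add] using h1
    · beta_reduce
      rw [((canonicalConnection r).cov X Y).2.2, X.2.2, Y.2.2]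
      simp only [canonicalTorsion, Ad_bracketM, map_sub, map_smul, map_neg]⟩
  add_left X X' Y := by
    refine Subtype.ext (funext fun g => ?_)
    simp only [(canonicalConnection r).add_left, Submodule.coe_add, Pi.add_apply, map_add,
      LinearMap.add_apply, canonicalTorsion]
    module
  smul_left f X Y := by
    refine Subtype.ext (funext fun g => ?_)
    rw [(canonicalConnection r).smul_left]
    simp only [SmoothFunction.smulField, map_smul, LinearMap.smul_apply, canonicalTorsion]
    module
  add_right X Y Y' := by
    refine Subtype.ext (funext fun g => ?_)
    simp only [(canonicalConnection r).add_right, Submodule.coe_add, Pi.add_apply, map_add,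
      canonicalTorsion]
    module
  leibniz f X Y g := by
    change ((canonicalConnection r).cov X (f.smulField Y)).1 g -
        (1 / 2 : ℝ) • canonicalTorsion (X.1 g) ((f.smulField Y).1 g) =
      f.lift g • (((canonicalConnection r).cov X Y).1 g -
        (1 / 2 : ℝ) • canonicalTorsion (X.1 g) (Y.1 g)) + fieldDeriv X f.lift g • Y.1 g
    rw [(canonicalConnection r).leibniz]
    simp only [SmoothFunction.smulField, map_smul, canonicalTorsion]
    module

/-! ### Riemannian metrics -/

/-- A Riemannian metric on `M`: `form g` is the inner product on the tangent space at `gH`,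
identified with `𝔪` through `v ↦ [g, v]`. As `[g h, Ad(h⁻¹) v] = [g, v]`, it has to be
`H`-equivariant. -/
structure RiemannianMetric (r : Fin 4 → ℕ) where
  form : G r → LinearMap.BilinForm ℝ (m r)
  form_mul : ∀ (g : G r) (h : H r) (v w : m r),
    form (g * (h : G r)) (Ad h⁻¹ v) (Ad h⁻¹ w) = form g v w
  symm : ∀ g v w, form g v w = form g w v
  pos : ∀ g v, v ≠ 0 → 0 < form g v v
  smooth : ∀ v w, IsSmooth fun g => form g v w

/-- Invariance under the left translations `τ_k : M → M`, whose differential maps `[g, v]` to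
`[k g, v]`. -/
def RiemannianMetric.IsInvariant {r : Fin 4 → ℕ} (μ : RiemannianMetric r) : Prop :=
  ∀ (k g : G r) (v w : m r), μ.form (k * g) v w = μ.form g v w

/-- `∇` is compatible with the metric: `X ⟨Y, Z⟩ = ⟨∇_X Y, Z⟩ + ⟨Y, ∇_X Z⟩`. -/
def AffineConnection.IsMetric {r : Fin 4 → ℕ} (D : AffineConnection r) (μ : RiemannianMetric r) :
    Prop :=
  ∀ (X Y Z : VectorField r) (g : G r),
    fieldDeriv X (fun k => μ.form k (Y.1 k) (Z.1 k)) g =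
      μ.form g ((D.cov X Y).1 g) (Z.1 g) + μ.form g (Y.1 g) ((D.cov X Z).1 g)

/-- `∇` is the Levi-Civita connection of `μ`, i.e. its (unique) torsion free metric connection. -/
def AffineConnection.IsLeviCivita {r : Fin 4 → ℕ} (D : AffineConnection r)
    (μ : RiemannianMetric r) : Prop :=
  D.IsTorsionFree ∧ D.IsMetric μ

/-- `μ` is adapted to the `ℤ₂ × ℤ₂`-symmetric structure: its Levi-Civita connection is the canonical
torsion free connection. -/
def RiemannianMetric.IsAdapted {r : Fin 4 → ℕ} (μ : RiemannianMetric r) : Prop :=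
  (torsionFreeConnection r).IsLeviCivita μ

/-- The sum of squares (in polarised form) of the coordinates of the blocks `(i, j)`, `i < j`,
i.e. of `A₁, B₁, C₁, C₂, B₂, A₂`. -/
def stdForm {r : Fin 4 → ℕ} (v w : m r) : ℝ :=
  ∑ i : Fin 4, ∑ j ∈ Finset.Ioi i, ∑ a : Fin (r i), ∑ b : Fin (r j),
    (v : Mat r) ⟨i, a⟩ ⟨j, b⟩ * (w : Mat r) ⟨i, a⟩ ⟨j, b⟩

end FlagManifold

namespace FlagManifold

attribute [local instance] Matrix.normedAddCommGroup Matrix.normedSpace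

variable {r : Fin 4 → ℕ}

/-! ### Fundamental vector fields and natural reductivity -/

/-! An invariant metric is one `Ad(H)`-invariant inner product `B` on `𝔪`. At the origin the
canonical torsion-free derivative is the canonical derivative plus `½[x, ·]_𝔪`. The canonical
derivative already preserves `B`, so metric compatibility says exactly that every `[x, ·]_𝔪` is skew
for `B` (`RiemannianMetric.IsAdapted.form_bracketM`). The rest is linear algebra on the vectors `E p
q`, with two tools: quarter turns in `H`, which relate indices of the same block, and skewness of
brackets, which relates indices of different blocks.

Equal lengths (`form_E_self_congr`): one of the two tools carries `E p q` to `± E p q'`, and chains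
of such moves connect all pairs. Orthogonality with one common index (`form_E_E_of_common`): a
quarter turn reverses the sign of the product, or else one vector is a bracket with the other.
Orthogonality with four distinct indices (`form_E_E_of_disjoint`): a fifth index is needed, and odd
size provides it. In size four with blocks 1, 1, 1, 1 the claim fails: the polarised Pfaffian is
also invariant and pairs `E₁₂` with `E₃₄`, so a small multiple of it can be added to `B`. -/

/-- The projection of a matrix onto `𝔪`: skew-symmetrise and delete the diagonal blocks. -/
def projM (r : Fin 4 → ℕ) : Mat r →ₗ[ℝ] m r where
  toFun Z := ⟨Matrix.of fun p q => if p.1 = q.1 then 0 else (1 / 2 : ℝ) * (Z p q - Z q p), by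
    refine mem_m.2 ⟨?_, fun p q hpq => by simp [hpq]⟩
    ext p q
    simp only [Matrix.transpose_apply, Matrix.of_apply, Matrix.neg_apply, eq_comm (a := q.1)]
    split_ifs <;> ring⟩
  map_add' Z W := by
    ext p q
    by_cases h : p.1 = q.1 <;> simp [h]
    ring
  map_smul' c Z := by
    ext p q
    by_cases h : p.1 = q.1 <;> simp [h]
    ring

theorem projM_coe (v : m r) : projM r (v : Mat r) = v := by
  obtain ⟨h1, h2⟩ := mem_m.1 v.2
  ext p q
  have h3 := congrFun (congrFun h1 p) q
  simp only [Matrix.transpose_apply, Matrix.neg_apply] at h3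
  by_cases h : p.1 = q.1
  · simp [projM, h, h2 p q h]
  · simp [projM, h, h3]
    ring

/-- Orthogonality of `h` makes conjugation commute with transposition, and block-diagonality makes
it preserve the off-diagonal part. -/
theorem projM_conj (h : H r) (Z : Mat r) :
    projM r (((h : G r) : Mat r) * Z * ((h : G r) : Mat r)ᵀ) = Ad h (projM r Z) := by
  refine Subtype.ext ?_
  have key : ∀ Z : Mat r, ((projM r Z : m r) : Mat r) =
      Matrix.of fun p q : Idx r => if p.1 = q.1 then 0 else ((1 / 2 : ℝ) • (Z - Zᵀ)) p q :=
    fun Z => rfl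
  change _ = ((h : G r) : Mat r) * ((projM r Z : m r) : Mat r) * ((h : G r) : Mat r)ᵀ
  rw [key, key, conj_offDiagonal]
  congr 1
  funext p q
  congr 2
  rw [Matrix.transpose_mul, Matrix.transpose_mul, Matrix.transpose_transpose, Matrix.mul_smul,
    Matrix.smul_mul, Matrix.mul_sub, Matrix.sub_mul, Matrix.mul_assoc _ Zᵀ]

theorem contDiff_transpose_mul_mul (A : Mat r) :
    ContDiff ℝ ∞ fun Z : Mat r => Zᵀ * A * Z := by
  have h1 : ContDiff ℝ ∞ fun Z : Mat r => Zᵀ * A :=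
    (LinearMap.mulRight ℝ A ∘ₗ
      (Matrix.transposeLinearEquiv (Idx r) (Idx r) ℝ ℝ).toLinearMap).toContinuousLinearMap.contDiff
  exact ((LinearMap.mul ℝ (Mat r)).toContinuousBilinearMap.contDiff.comp h1).clm_apply contDiff_id

/-- On `G` the inverse is the transpose, so the expression extends to a polynomial map on all
matrices. This is why `projM` is defined on the whole matrix space. -/
theorem isSmooth_projM_conj (A : Mat r) :
    IsSmooth fun g : G r => projM r ((g : Mat r)ᵀ * A * (g : Mat r)) := fun g => by
  have h := (projM r).toContinuousLinearMap.contDiff (n := ∞).comp (contDiff_transpose_mul_mul A)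
  exact ⟨fun Z => projM r (Zᵀ * A * Z), h.contDiffAt, Filter.Eventually.of_forall fun _ => rfl⟩

theorem projM_conj_mul (A : Mat r) (g : G r) (h : H r) :
    projM r (((g * (h : G r) : G r) : Mat r)ᵀ * A * ((g * (h : G r) : G r) : Mat r)) =
      Ad h⁻¹ (projM r ((g : Mat r)ᵀ * A * (g : Mat r))) := by
  rw [← projM_conj]
  refine congrArg (projM r) ?_
  have h1 : (((h⁻¹ : H r) : G r) : Mat r) = ((h : G r) : Mat r)ᵀ := rfl
  have h2 : ((g * (h : G r) : G r) : Mat r) = (g : Mat r) * ((h : G r) : Mat r) := rfl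
  rw [h1, h2, Matrix.transpose_mul, Matrix.transpose_transpose]
  noncomm_ring

/-- The vector field on `M` induced by the one-parameter group `exp(t A)`, `A ∈ 𝔪`. -/
def fundamentalField (A : m r) : VectorField r :=
  ⟨fun g => projM r ((g : Mat r)ᵀ * (A : Mat r) * (g : Mat r)), isSmooth_projM_conj _,
    projM_conj_mul _⟩

/-- Every tangent vector at the origin thus extends to a global vector field, which allows metric
compatibility to be tested pointwise. -/
theorem fundamentalField_one (A : m r) : (fundamentalField A).1 1 = A := by
  change projM r (((1 : G r) : Mat r)ᵀ * (A : Mat r) * ((1 : G r) : Mat r)) = A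
  rw [OneMemClass.coe_one, Matrix.transpose_one, one_mul, mul_one, projM_coe]

/-- Left translations become the identity in the identification `v ↦ [g, v]`, so an invariant metric
is constant in `g`. -/
theorem RiemannianMetric.IsInvariant.form_eq {μ : RiemannianMetric r} (hinv : μ.IsInvariant)
    (g : G r) : μ.form g = μ.form 1 := by
  ext v w
  simpa using hinv g 1 v w

theorem RiemannianMetric.IsInvariant.form_Ad {μ : RiemannianMetric r} (hinv : μ.IsInvariant)
    (h : H r) (v w : m r) : μ.form 1 (Ad h v) (Ad h w) = μ.form 1 v w := by
  have := μ.form_mul 1 h⁻¹ v w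
  rwa [inv_inv, hinv.form_eq] at this

theorem hasDerivAt_bilinForm {V : Type*} [NormedAddCommGroup V] [NormedSpace ℝ V]
    [FiniteDimensional ℝ V] (B : LinearMap.BilinForm ℝ V) {Y Z : ℝ → V} {y z : V} {t : ℝ}
    (hY : HasDerivAt Y y t) (hZ : HasDerivAt Z z t) :
    HasDerivAt (fun s => B (Y s) (Z s)) (B y (Z t) + B (Y t) z) t :=
  (B.toContinuousBilinearMap.hasFDerivAt.comp_hasDerivAt t hY).clm_apply hZ

/-- An adapted invariant metric is naturally reductive. -/
theorem RiemannianMetric.IsAdapted.form_bracketM {μ : RiemannianMetric r}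
    (hadapted : μ.IsAdapted) (hinv : μ.IsInvariant) (x y z : m r) :
    μ.form 1 (bracketM r x y) z = -μ.form 1 y (bracketM r x z) := by
  let X := fundamentalField x
  let Y := fundamentalField y
  let Z := fundamentalField z
  have hX : X.1 1 = x := fundamentalField_one x
  have hY : Y.1 1 = y := fundamentalField_one y
  have hZ : Z.1 1 = z := fundamentalField_one z
  have h1 := hadapted.2 X Y Z 1
  have h2 : fieldDeriv X (fun k => μ.form k (Y.1 k) (Z.1 k)) 1 =
      μ.form 1 (dirDeriv Y.1 1 x) z + μ.form 1 y (dirDeriv Z.1 1 x) := by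
    have h4 := hasDerivAt_bilinForm (μ.form 1) (Y.2.1.hasDerivAt 1 x) (Z.2.1.hasDerivAt 1 x)
    simp only [zero_smul, expG_zero, mul_one, hY, hZ] at h4
    have h5 := h4.deriv
    simp only [fieldDeriv, dirDeriv, hX, hinv.form_eq] at h5 ⊢
    exact h5
  -- The plus sign arises from subtracting half of `T(x, w) = -[x, w]_𝔪`.
  have h6 : ∀ W : VectorField r, (((torsionFreeConnection r).cov X W).1 1 : m r) =
      dirDeriv W.1 1 x + (1 / 2 : ℝ) • bracketM r x (W.1 1) := fun W => by
    change dirDeriv W.1 1 (X.1 1) - (1 / 2 : ℝ) • -bracketM r (X.1 1) (W.1 1) = _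
    rw [hX, smul_neg, sub_neg_eq_add]
  -- The derivatives of `Y` and `Z` occur on both sides and cancel, leaving only the bracket terms.
  rw [h2, h6, h6, hY, hZ] at h1
  simp only [map_add, map_smul, LinearMap.add_apply, LinearMap.smul_apply, smul_eq_mul] at h1
  linarith

/-! ### The standard basis of `𝔪` -/

/-- The element `E_pq - E_qp` of `𝔪` if `p` and `q` belong to different blocks, and `0` otherwise. -/
def E (p q : Idx r) : m r := projM r ((2 : ℝ) • Matrix.single p q 1)

theorem coe_E {p q : Idx r} (h : p.1 ≠ q.1) :
    (E p q : Mat r) = Matrix.single p q 1 - Matrix.single q p 1 := by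
  ext s t
  simp only [E, projM, LinearMap.coe_mk, AddHom.coe_mk, Matrix.of_apply, Matrix.smul_apply,
    Matrix.sub_apply, smul_eq_mul]
  split_ifs with hst
  · rw [Matrix.single_apply_of_ne, Matrix.single_apply_of_ne, sub_zero]
    · rintro ⟨rfl, rfl⟩
      exact h hst.symm
    · rintro ⟨rfl, rfl⟩
      exact h hst
  · simp only [Matrix.single_apply, and_comm (a := p = t)]
    ring

theorem E_of_fst_eq {p q : Idx r} (h : p.1 = q.1) : E p q = 0 := by
  ext s t
  simp only [E, projM, LinearMap.coe_mk, AddHom.coe_mk, Matrix.of_apply, Matrix.smul_apply,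
    smul_eq_mul]
  split_ifs with hst
  · rfl
  · rw [Matrix.single_apply_of_ne, Matrix.single_apply_of_ne]
    · simp
    · rintro ⟨rfl, rfl⟩
      exact hst h.symm
    · rintro ⟨rfl, rfl⟩
      exact hst h

theorem E_swap (p q : Idx r) : E q p = -E p q := by
  by_cases h : p.1 = q.1
  · rw [E_of_fst_eq h, E_of_fst_eq h.symm, neg_zero]
  · refine Subtype.ext ?_
    rw [Submodule.coe_neg, coe_E h, coe_E (Ne.symm h), neg_sub]

theorem coe_bracketM (X Y : m r) : (bracketM r X Y : Mat r) =
    Matrix.of fun p q => if p.1 = q.1 then 0 else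
      ((X : Mat r) * (Y : Mat r) - (Y : Mat r) * (X : Mat r)) p q := rfl

/-- With three different blocks the full commutator is already off-diagonal, so projecting to `𝔪`
loses nothing. -/
theorem bracketM_E_E {p q s : Idx r} (hpq : p.1 ≠ q.1) (hqs : q.1 ≠ s.1) (hps : p.1 ≠ s.1) :
    bracketM r (E p q) (E q s) = E p s := by
  have h1 : p ≠ q := fun h => hpq (congrArg _ h)
  have h2 : q ≠ s := fun h => hqs (congrArg _ h)
  have h3 : p ≠ s := fun h => hps (congrArg _ h)
  rw [← projM_coe (E p s)]
  refine Subtype.ext ?_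
  rw [coe_bracketM, projM_coe, coe_E hpq, coe_E hqs]
  have key : (Matrix.single p q 1 - Matrix.single q p 1) *
      (Matrix.single q s 1 - Matrix.single s q 1) -
      (Matrix.single q s 1 - Matrix.single s q 1) *
      (Matrix.single p q 1 - Matrix.single q p 1) = (E p s : Mat r) := by
    rw [coe_E hps]
    simp [mul_sub, sub_mul, h1, h1.symm, h2, h2.symm, h3, h3.symm]
  rw [key]
  ext a b
  rw [Matrix.of_apply]
  split_ifs with hab
  · exact ((mem_m.1 (E p s).2).2 a b hab).symm
  · rfl

theorem bracketM_E_E_of_disjoint {p q s t : Idx r} (hpq : p.1 ≠ q.1) (hst : s.1 ≠ t.1)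
    (hps : p ≠ s) (hpt : p ≠ t) (hqs : q ≠ s) (hqt : q ≠ t) :
    bracketM r (E p q) (E s t) = 0 := by
  refine Subtype.ext ?_
  have key : (Matrix.single p q 1 - Matrix.single q p 1) *
      (Matrix.single s t 1 - Matrix.single t s 1) -
      (Matrix.single s t 1 - Matrix.single t s 1) *
      (Matrix.single p q 1 - Matrix.single q p 1) = (0 : Mat r) := by
    simp [mul_sub, sub_mul, hps, hps.symm, hpt, hpt.symm, hqs, hqs.symm, hqt, hqt.symm]
  rw [coe_bracketM, coe_E hpq, coe_E hst, key]
  ext a b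
  simp

/-- The factor ½ compensates for counting each unordered pair twice, since `v` and `E` are both
antisymmetric in the two indices. -/
theorem sum_smul_E (v : m r) : v = (1 / 2 : ℝ) • ∑ p, ∑ q, (v : Mat r) p q • E p q := by
  have h : (v : Mat r) = ∑ p, ∑ q, (v : Mat r) p q • Matrix.single p q (1 : ℝ) := by
    simpa using Matrix.matrix_eq_sum_single (v : Mat r)
  nth_rewrite 1 [← projM_coe v, h]
  simp only [E, map_sum, map_smul, Finset.smul_sum, smul_smul]
  refine Finset.sum_congr rfl fun p _ => Finset.sum_congr rfl fun q _ => ?_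
  congr 1
  ring

/-! ### Quarter turns in the isotropy group -/

/-- The quarter turn `e_a ↦ e_b ↦ -e_a` of the plane spanned by two basis vectors. -/
def quarterTurn {ι : Type*} [DecidableEq ι] (a b : ι) : Matrix ι ι ℝ :=
  Matrix.of fun x y => if x = Equiv.swap a b y then (if y = b then -1 else 1) else 0

theorem quarterTurn_mem {ι : Type*} [Fintype ι] [DecidableEq ι] {a b : ι} (hab : a ≠ b) :
    quarterTurn a b ∈ Matrix.specialOrthogonalGroup ι ℝ := by
  -- This factorisation serves the determinant: the sign of the transposition cancels the entry -1
  -- of the diagonal factor.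
  have h : quarterTurn a b = (Equiv.swap a b).permMatrix ℝ *
      Matrix.diagonal (Function.update (1 : ι → ℝ) b (-1)) := by
    ext x y
    rw [Matrix.mul_diagonal, Equiv.Perm.permMatrix, PEquiv.toMatrix_apply]
    simp only [quarterTurn, Matrix.of_apply, Equiv.toPEquiv_apply, Option.mem_def,
      Option.some.injEq, Function.update_apply, Pi.one_apply]
    have : x = Equiv.swap a b y ↔ Equiv.swap a b x = y := by
      rw [Equiv.swap_apply_eq_iff]
    simp only [this]
    split_ifs <;> simp
  refine Matrix.mem_specialOrthogonalGroup_iff.2 ⟨?_, ?_⟩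
  · refine (Matrix.mem_orthogonalGroup_iff _ _).2 ?_
    change quarterTurn a b * (quarterTurn a b)ᵀ = 1
    ext x y
    rw [Matrix.mul_apply, Finset.sum_eq_single (Equiv.swap a b x)]
    · simp only [quarterTurn, Matrix.transpose_apply, Matrix.of_apply, Equiv.swap_apply_self,
        Matrix.one_apply, eq_comm (a := y)]
      split_ifs <;> norm_num
    · intro z _ hz
      have : x ≠ Equiv.swap a b z := fun h => hz (by rw [h, Equiv.swap_apply_self])
      simp [quarterTurn, this]
    · simp
  · rw [h, Matrix.det_mul, Matrix.det_permutation, Equiv.Perm.sign_swap hab, Matrix.det_diagonal,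
      Finset.prod_update_of_mem (Finset.mem_univ b)]
    simp

/-- The rotation moves only indices of one block, so it comes from a single factor `SO(rᵢ)`, with
the identity in the others. -/
theorem exists_quarterTurn {p p' : Idx r} (hne : p ≠ p') (hpp : p.1 = p'.1) :
    ∃ h : H r, ((h : G r) : Mat r) = quarterTurn p p' := by
  obtain ⟨i, a⟩ := p
  obtain ⟨j, b⟩ := p'
  obtain rfl : i = j := hpp
  have hab : a ≠ b := fun h => hne (by rw [h])
  let N : ∀ i, Matrix.specialOrthogonalGroup (Fin (r i)) ℝ :=
    Pi.mulSingle i ⟨quarterTurn a b, quarterTurn_mem hab⟩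
  refine ⟨⟨_, N, rfl⟩, ?_⟩
  ext ⟨k, x⟩ ⟨k', y⟩
  change Matrix.blockDiagonal' (fun i => (N i : Matrix (Fin (r i)) (Fin (r i)) ℝ)) _ _ = _
  by_cases hk : k = k'
  · subst hk
    rw [Matrix.blockDiagonal'_apply_eq]
    by_cases hi : k = i
    · subst hi
      rw [show N k = _ from Pi.mulSingle_eq_same _ _]
      simp only [quarterTurn, Matrix.of_apply, Equiv.swap_apply_def, Sigma.mk.injEq, heq_eq_eq,
        true_and]
      split_ifs <;> simp_all
    · rw [show N k = 1 from Pi.mulSingle_eq_of_ne hi _]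
      simp [quarterTurn, Equiv.swap_apply_def, hi, Matrix.one_apply]
  · rw [Matrix.blockDiagonal'_apply_ne _ _ _ hk]
    simp only [quarterTurn, Matrix.of_apply, Equiv.swap_apply_def, Sigma.mk.injEq]
    split_ifs <;> simp_all

/-- The columns of a quarter turn are signed basis vectors. -/
theorem quarterTurn_col {ι : Type*} [DecidableEq ι] (a b y x : ι) :
    quarterTurn a b x y = (if y = b then -1 else 1) * (Pi.single (Equiv.swap a b y) 1 : ι → ℝ) x := by
  simp only [quarterTurn, Matrix.of_apply, Pi.single_apply]
  split_ifs <;> simp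

/-- Conjugation sends the matrix unit of `(q, s)` to the product of columns `q` and `s` of the
quarter turn, each a signed basis vector; `projM` is equivariant. -/
theorem Ad_E {p p' : Idx r} {h : H r}
    (hh : ((h : G r) : Mat r) = quarterTurn p p') (q s : Idx r) :
    Ad h (E q s) = ((if q = p' then -1 else 1) * (if s = p' then -1 else 1) : ℝ) •
      E (Equiv.swap p p' q) (Equiv.swap p p' s) := by
  rw [E, ← projM_conj, E, ← map_smul]
  congr 1
  rw [Matrix.mul_smul, Matrix.smul_mul, smul_comm]
  congr 1
  ext a b
  rw [hh]
  simp only [Matrix.mul_apply, Matrix.single_apply, Matrix.transpose_apply, Matrix.smul_apply]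
  rw [Finset.sum_eq_single s, Finset.sum_eq_single q]
  · rw [quarterTurn_col, quarterTurn_col]
    simp only [Pi.single_apply, smul_eq_mul, eq_comm (a := a), eq_comm (a := b)]
    split_ifs <;> simp_all
  · intro x _ hx
    simp [hx.symm]
  · simp
  · intro x _ hx
    simp [hx.symm]
  · simp

/-! ### Naturally reductive invariant inner products -/

variable {B : LinearMap.BilinForm ℝ (m r)}

theorem form_quarterTurn (hAd : ∀ (h : H r) (v w : m r), B (Ad h v) (Ad h w) = B v w)
    {p p' : Idx r} (hne : p ≠ p') (hpp : p.1 = p'.1) (q s t u : Idx r) :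
    B (E q s) (E t u) =
      ((if q = p' then -1 else 1) * (if s = p' then -1 else 1)) *
      ((if t = p' then -1 else 1) * (if u = p' then -1 else 1)) *
      B (E (Equiv.swap p p' q) (Equiv.swap p p' s)) (E (Equiv.swap p p' t) (Equiv.swap p p' u)) := by
  obtain ⟨h, hh⟩ := exists_quarterTurn hne hpp
  rw [← hAd h, Ad_E hh, Ad_E hh]
  simp only [map_smul, LinearMap.smul_apply, smul_eq_mul]
  ring

theorem form_E_self_congr_right
    (hAd : ∀ (h : H r) (v w : m r), B (Ad h v) (Ad h w) = B v w)
    (hbr : ∀ x y z : m r, B (bracketM r x y) z = -B y (bracketM r x z))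
    {p q q' : Idx r} (hq : p.1 ≠ q.1) (hq' : p.1 ≠ q'.1) :
    B (E p q) (E p q) = B (E p q') (E p q') := by
  have h1 : p ≠ q := fun h => hq (congrArg _ h)
  have h2 : p ≠ q' := fun h => hq' (congrArg _ h)
  by_cases hqq : q = q'
  · rw [hqq]
  by_cases hb : q.1 = q'.1
  -- Same block: the quarter turn in the plane of `q`, `q'` carries one vector to the other.
  · rw [form_quarterTurn hAd hqq hb p q p q, Equiv.swap_apply_left,
      Equiv.swap_apply_of_ne_of_ne h1 h2, if_neg h2, if_neg hqq]
    ring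
  -- Three different blocks: bracketing with `E q' q` rotates the plane of `E q p` and `E q' p`, and
  -- skewness makes their lengths equal.
  · have h3 := hbr (E q' q) (E q p) (E q' p)
    rw [bracketM_E_E (Ne.symm hb) (Ne.symm hq) (Ne.symm hq'), E_swap q q',
      map_neg, LinearMap.neg_apply, bracketM_E_E hb (Ne.symm hq') (Ne.symm hq)] at h3
    rw [E_swap q p, E_swap q' p]
    simp only [map_neg, LinearMap.neg_apply, neg_neg] at h3 ⊢
    exact h3.symm

/-- Replacing one index at a time connects any two pairs; the case split picks an intermediate pair
whose indices lie in different blocks. -/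
theorem form_E_self_congr
    (hAd : ∀ (h : H r) (v w : m r), B (Ad h v) (Ad h w) = B v w)
    (hbr : ∀ x y z : m r, B (bracketM r x y) z = -B y (bracketM r x z))
    {p q s t : Idx r} (hpq : p.1 ≠ q.1) (hst : s.1 ≠ t.1) :
    B (E p q) (E p q) = B (E s t) (E s t) := by
  have hswap : ∀ a b : Idx r, B (E a b) (E a b) = B (E b a) (E b a) := fun a b => by
    rw [E_swap b a, map_neg, map_neg, LinearMap.neg_apply, neg_neg]
  by_cases hpt : p.1 = t.1
  · have hps : p.1 ≠ s.1 := fun h => hst (h.symm.trans hpt)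
    rw [form_E_self_congr_right hAd hbr hpq hps, hswap,
      form_E_self_congr_right hAd hbr (Ne.symm hps) hst]
  · rw [form_E_self_congr_right hAd hbr hpq hpt, hswap,
      form_E_self_congr_right hAd hbr (Ne.symm hpt) (Ne.symm hst), hswap]

theorem form_E_E_of_common (hsymm : ∀ v w, B v w = B w v)
    (hAd : ∀ (h : H r) (v w : m r), B (Ad h v) (Ad h w) = B v w)
    (hbr : ∀ x y z : m r, B (bracketM r x y) z = -B y (bracketM r x z))
    {p q t : Idx r} (hpq : p.1 ≠ q.1) (hpt : p.1 ≠ t.1) (hqt : q ≠ t) :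
    B (E p q) (E p t) = 0 := by
  have h1 : p ≠ q := fun h => hpq (congrArg _ h)
  have h2 : p ≠ t := fun h => hpt (congrArg _ h)
  by_cases hb : q.1 = t.1
  -- The quarter turn sends `E p q` to `E p t` and `E p t` to `-E p q`, so the product equals its
  -- own negative.
  · have h3 := form_quarterTurn hAd hqt hb p q p t
    rw [Equiv.swap_apply_left, Equiv.swap_apply_right, Equiv.swap_apply_of_ne_of_ne h1 h2,
      if_neg h2, if_neg hqt, if_pos rfl, hsymm (E p t)] at h3
    linarith
  -- `E p t` is in the image of the skew map `[E p q, ·]_𝔪`, and `E p q` is in its kernel.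
  · have h3 := hbr (E p q) (E q t) (E p q)
    have h4 : bracketM r (E p q) (E p q) = 0 := by
      refine Subtype.ext ?_
      rw [coe_bracketM, sub_self]
      ext
      simp
    rw [bracketM_E_E hpq hb hpt, h4, map_zero, neg_zero, hsymm] at h3
    exact h3

theorem form_E_E_of_disjoint (hodd : Odd (Fintype.card (Idx r)))
    (hAd : ∀ (h : H r) (v w : m r), B (Ad h v) (Ad h w) = B v w)
    (hbr : ∀ x y z : m r, B (bracketM r x y) z = -B y (bracketM r x z))
    {p q s t : Idx r} (hpq : p.1 ≠ q.1) (hst : s.1 ≠ t.1)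
    (hps : p ≠ s) (hpt : p ≠ t) (hqs : q ≠ s) (hqt : q ≠ t) :
    B (E p q) (E s t) = 0 := by
  have h1 : p ≠ q := fun h => hpq (congrArg _ h)
  have h2 : s ≠ t := fun h => hst (congrArg _ h)
  obtain ⟨k, hk⟩ : ∃ k, k ∉ ({p, q, s, t} : Finset (Idx r)) := by
    -- Without a fifth index the matrix size would be exactly 4, which is even.
    by_contra! hall
    have h3 : ({p, q, s, t} : Finset (Idx r)) = Finset.univ := Finset.eq_univ_iff_forall.2 hall
    have h4 : ({p, q, s, t} : Finset (Idx r)).card = 4 := by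
      rw [Finset.card_insert_of_notMem (by simp [h1, hps, hpt]),
        Finset.card_insert_of_notMem (by simp [hqs, hqt]), Finset.card_pair h2]
    rw [h3, Finset.card_univ] at h4
    rw [h4] at hodd
    exact absurd hodd (by decide)
  simp only [Finset.mem_insert, Finset.mem_singleton, not_or] at hk
  obtain ⟨hkp, hkq, hks, hkt⟩ := hk
  -- two quarter turns in the plane of `a, k` change the signs of `e_a` and `e_k`
  have flip : ∀ a b : Idx r, a.1 = k.1 → a ≠ k → b ≠ a → b ≠ k → a ≠ s → a ≠ t →
      B (E a b) (E s t) = 0 := fun a b hak hne hba hbk has hat => by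
    have h3 := form_quarterTurn hAd hne hak a b s t
    have h4 := form_quarterTurn hAd hne hak k b s t
    rw [Equiv.swap_apply_left, Equiv.swap_apply_of_ne_of_ne hba hbk,
      Equiv.swap_apply_of_ne_of_ne has.symm (Ne.symm hks),
      Equiv.swap_apply_of_ne_of_ne hat.symm (Ne.symm hkt), if_neg hne, if_neg hbk,
      if_neg (Ne.symm hks), if_neg (Ne.symm hkt)] at h3
    rw [Equiv.swap_apply_right, Equiv.swap_apply_of_ne_of_ne hba hbk,
      Equiv.swap_apply_of_ne_of_ne has.symm (Ne.symm hks),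
      Equiv.swap_apply_of_ne_of_ne hat.symm (Ne.symm hkt), if_pos rfl, if_neg hbk,
      if_neg (Ne.symm hks), if_neg (Ne.symm hkt)] at h4
    linarith
  by_cases hbp : p.1 = k.1
  · exact flip p q hbp (Ne.symm hkp) h1.symm (Ne.symm hkq) hps hpt
  by_cases hbq : q.1 = k.1
  · rw [E_swap q p, map_neg, LinearMap.neg_apply,
      flip q p hbq (Ne.symm hkq) h1 (Ne.symm hkp) hqs hqt, neg_zero]
  -- Here `k` lies in a third block, so `E q p = [E q k, E k p]_𝔪`; skewness moves `E q k` onto `E s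
  -- t`, with which it commutes.
  · rw [E_swap q p, ← bracketM_E_E hbq (Ne.symm hbp) (Ne.symm hpq), map_neg,
      LinearMap.neg_apply, hbr,
      bracketM_E_E_of_disjoint hbq hst hqs hqt hks hkt, map_zero, neg_zero, neg_zero]

/-- The entry at `(s, t)` is 1, -1 or 0, so orthogonality and the sign from reversing an index pair
fit in one formula, linear in the first argument. -/
theorem form_E_E (hodd : Odd (Fintype.card (Idx r))) (hsymm : ∀ v w, B v w = B w v)
    (hAd : ∀ (h : H r) (v w : m r), B (Ad h v) (Ad h w) = B v w)
    (hbr : ∀ x y z : m r, B (bracketM r x y) z = -B y (bracketM r x z))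
    {p q s t : Idx r} (hpq : p.1 ≠ q.1) (hst : s.1 ≠ t.1) :
    B (E p q) (E s t) = B (E s t) (E s t) * (E p q : Mat r) s t := by
  have h1 : p ≠ q := fun h => hpq (congrArg _ h)
  have h2 : s ≠ t := fun h => hst (congrArg _ h)
  -- The condition excludes pairs that meet `(s, t)` only crosswise; if `(p, q)` fails it, then `(q,
  -- p)` satisfies it.
  have key : ∀ a b : Idx r, a.1 ≠ b.1 → (a = s ∨ (b ≠ s ∧ a ≠ t)) →
      B (E a b) (E s t) = B (E s t) (E s t) * (E a b : Mat r) s t := fun a b hab h => by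
    rw [coe_E hab]
    rcases h with rfl | ⟨hbs, hat⟩
    · by_cases hbt : b = t
      · subst hbt
        simp [h2, h2.symm]
      · rw [form_E_E_of_common hsymm hAd hbr hab hst hbt]
        simp [hbt, h2]
    · by_cases has : a = s
      · subst has
        by_cases hbt : b = t
        · subst hbt
          simp [h2, h2.symm]
        · rw [form_E_E_of_common hsymm hAd hbr hab hst hbt]
          simp [hbt, h2]
      · by_cases hbt : b = t
        · subst hbt
          rw [E_swap b a, E_swap b s, map_neg, map_neg, LinearMap.neg_apply, neg_neg,
            form_E_E_of_common hsymm hAd hbr (Ne.symm hab) (Ne.symm hst) has]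
          simp [has, hbs]
        · rw [form_E_E_of_disjoint hodd hAd hbr hab hst has hat hbs hbt]
          simp [has, hbs]
  by_cases h : p = s ∨ (q ≠ s ∧ p ≠ t)
  · exact key p q hpq h
  · rw [E_swap q p, map_neg, LinearMap.neg_apply, key q p (Ne.symm hpq) (by grind),
      Submodule.coe_neg, Matrix.neg_apply, mul_neg]

/-- Diagonal blocks vanish, and blocks `(i, j)` and `(j, i)` contribute equally because the two
signs cancel. -/
theorem stdForm_eq (v w : m r) :
    stdForm v w = (1 / 2 : ℝ) * ∑ p, ∑ q, (v : Mat r) p q * (w : Mat r) p q := by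
  let F : Fin 4 → Fin 4 → ℝ := fun i j => ∑ a : Fin (r i), ∑ b : Fin (r j),
    (v : Mat r) ⟨i, a⟩ ⟨j, b⟩ * (w : Mat r) ⟨i, a⟩ ⟨j, b⟩
  have hdiag : ∀ i, F i i = 0 := fun i =>
    Finset.sum_eq_zero fun a _ => Finset.sum_eq_zero fun b _ => by
      change (v : Mat r) ⟨i, a⟩ ⟨i, b⟩ * (w : Mat r) ⟨i, a⟩ ⟨i, b⟩ = 0
      rw [(mem_m.1 v.2).2 ⟨i, a⟩ ⟨i, b⟩ rfl, zero_mul]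
  have hF : ∀ i j, F j i = F i j := fun i j => by
    change ∑ a : Fin (r j), ∑ b : Fin (r i), _ = _
    rw [Finset.sum_comm]
    refine Finset.sum_congr rfl fun a _ => Finset.sum_congr rfl fun b _ => ?_
    have h1 := congrFun (congrFun (mem_m.1 v.2).1 ⟨i, a⟩) ⟨j, b⟩
    have h2 := congrFun (congrFun (mem_m.1 w.2).1 ⟨i, a⟩) ⟨j, b⟩
    simp only [Matrix.transpose_apply, Matrix.neg_apply] at h1 h2
    rw [h1, h2, neg_mul_neg]
  have h1 : ∑ p, ∑ q, (v : Mat r) p q * (w : Mat r) p q = ∑ i, ∑ j, F i j := by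
    simp only [Fintype.sum_sigma, F]
    exact Finset.sum_congr rfl fun i _ => Finset.sum_comm
  have h2 : stdForm v w = ∑ i, ∑ j ∈ Finset.Ioi i, F i j := rfl
  have h3 : Finset.Ioi (0 : Fin 4) = {1, 2, 3} := by decide
  have h4 : Finset.Ioi (1 : Fin 4) = {2, 3} := by decide
  have h5 : Finset.Ioi (2 : Fin 4) = {3} := by decide
  have h6 : Finset.Ioi (3 : Fin 4) = ∅ := by decide
  rw [h1, h2]
  simp only [Fin.sum_univ_four, h3, h4, h5, h6, hdiag, Finset.sum_empty, Finset.sum_singleton]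
  rw [Finset.sum_insert (by decide), Finset.sum_insert (by decide), Finset.sum_insert (by decide)]
  simp only [Finset.sum_singleton]
  rw [hF 0 1, hF 0 2, hF 0 3, hF 1 2, hF 1 3, hF 2 3]
  ring

/-- Naturally reductive `Ad(H)`-invariant symmetric bilinear forms on `𝔪` are multiples of the
standard one. -/
theorem exists_form_eq_mul_stdForm (hodd : Odd (Fintype.card (Idx r)))
    (hsymm : ∀ v w, B v w = B w v)
    (hAd : ∀ (h : H r) (v w : m r), B (Ad h v) (Ad h w) = B v w)
    (hbr : ∀ x y z : m r, B (bracketM r x y) z = -B y (bracketM r x z))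
    (hpos : ∀ v, v ≠ 0 → 0 < B v v) :
    ∃ t : ℝ, 0 < t ∧ ∀ v w, B v w = t * stdForm v w := by
  obtain ⟨t, ht, h⟩ : ∃ t : ℝ, 0 < t ∧ ∀ p q : Idx r, p.1 ≠ q.1 → B (E p q) (E p q) = t := by
    by_cases hex : ∃ p q : Idx r, p.1 ≠ q.1
    · obtain ⟨p, q, hpq⟩ := hex
      refine ⟨B (E p q) (E p q), hpos _ fun h0 => ?_, fun s t hst =>
        form_E_self_congr hAd hbr hst hpq⟩
      have h1 : p ≠ q := fun h => hpq (congrArg _ h)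
      have h2 := congrFun (congrFun (congrArg Subtype.val h0) p) q
      rw [coe_E hpq] at h2
      simp [h1, h1.symm] at h2
    · push Not at hex
      -- All indices lie in one block, so `𝔪 = 0` and any positive constant serves.
      exact ⟨1, one_pos, fun p q hpq => absurd (hex p q) hpq⟩
  -- Pairing with `E s u` reads off a coordinate up to the factor `t`; expanding the second argument
  -- then determines `B`.
  have hE : ∀ (v : m r) (s u : Idx r), B v (E s u) = t * (v : Mat r) s u := fun v s u => by
    by_cases hsu : s.1 = u.1
    · rw [E_of_fst_eq hsu, (mem_m.1 v.2).2 s u hsu, map_zero, mul_zero]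
    · have h1 : ∀ p q : Idx r, B (E p q) (E s u) = t * (E p q : Mat r) s u := fun p q => by
        by_cases hpq : p.1 = q.1
        · rw [E_of_fst_eq hpq]
          simp
        · rw [form_E_E hodd hsymm hAd hbr hpq hsu, h s u hsu]
      have h2 := sum_smul_E v
      have h3 := congrArg (fun x : m r => B x (E s u)) h2
      have h4 := congrArg (fun x : m r => (x : Mat r) s u) h2
      simp only [map_smul, map_sum, LinearMap.smul_apply, LinearMap.sum_apply, smul_eq_mul,
        h1, Submodule.coe_smul, Submodule.coe_sum, Matrix.smul_apply, Matrix.sum_apply] at h3 h4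
      rw [h3, h4]
      simp only [Finset.mul_sum]
      refine Finset.sum_congr rfl fun p _ => Finset.sum_congr rfl fun q _ => ?_
      ring
  refine ⟨t, ht, fun v w => ?_⟩
  have h3 := congrArg (B v) (sum_smul_E w)
  simp only [map_smul, map_sum, smul_eq_mul, hE] at h3
  rw [h3, stdForm_eq]
  simp only [Finset.mul_sum]
  refine Finset.sum_congr rfl fun p _ => Finset.sum_congr rfl fun q _ => ?_
  ring

end FlagManifold

theorem mainTheorem1 (l : ℕ) (r : Fin 4 → ℕ) (hr : ∑ i, r i = 2 * l + 1)
    (μ : FlagManifold.RiemannianMetric r) (hinv : μ.IsInvariant) (hadapted : μ.IsAdapted) :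
    ∃ t : ℝ, 0 < t ∧ ∀ (g : FlagManifold.G r) (v w : FlagManifold.m r),
      μ.form g v w = t * FlagManifold.stdForm v w := by
  have hodd : Odd (Fintype.card (FlagManifold.Idx r)) := by
    rw [Fintype.card_sigma]
    simp only [Fintype.card_fin, hr]
    exact odd_two_mul_add_one l
  obtain ⟨t, ht, h⟩ := FlagManifold.exists_form_eq_mul_stdForm hodd (μ.symm 1) hinv.form_Ad
    (hadapted.form_bracketM hinv) (μ.pos 1)
  exact ⟨t, ht, fun g v w => by rw [hinv.form_eq, h]⟩
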